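/- There are absolute constants $c, C$ and a deterministic algorithm in the Congested Clique model with the following property. Let $G$ be an undirected simple graph with $n$ nodes and $m$ edges. The nodes of $G$ are the $n$ nodes of a fully connected synchronous network; each node initially knows only $n$, its own identifier and the set of its neighbours in $G$ (in particular, $m$ is not given), and in each round each node may send to every other node one message (possibly different for different recipients) of at most $c\lceil\log_2 n\rceil$ bits, local computation being free. Then after at most $C\left(\frac{m^{2/3}}{n}+1\right)$ rounds, i.e. in $O(m^{2/3}/n+1)$ rounds, all nodes have terminated, and each of them outputs the number of $4$-cycles of $G$, that is, the number of (not necessarily induced) subgraphs of $G$ isomorphic to the cycle $C_4$. -/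

import Mathlib

/-- A deterministic algorithm in the Congested Clique model on the nodes `Fin n`, with a bandwidth
of `B` bits per message. Every node `v` starts from its identifier and its own part of the input.
In each round every node sends to every node either nothing (`none`) or one message of `B` bits;
the message may differ from recipient to recipient and is a function of the sender's local state.
The node then updates its state from the messages that it received. Local computation is free.
`output v s = some o` means that a node `v` in state `s` has terminated with output `o`. -/
structure CongestedCliqueAlgorithm (n B : ℕ) (Input Output : Type) where
  State : Type
  init : Fin n → Input → State
  send : (sender : Fin n) → State → (recipient : Fin n) → Option (BitVec B)
  update : Fin n → State → (received : Fin n → Option (BitVec B)) → State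
  output : Fin n → State → Option Output

namespace CongestedCliqueAlgorithm

variable {n B : ℕ} {Input Output : Type}

/-- What node `u` in state `s` puts on its link to node `w`: a terminated node is silent. -/
def message (A : CongestedCliqueAlgorithm n B Input Output) (u : Fin n) (s : A.State)
    (w : Fin n) : Option (BitVec B) :=
  if (A.output u s).isSome then none else A.send u s w

/-- The states of all nodes after `t` synchronous rounds, when node `v` gets the input `input v`.
A terminated node keeps its state, hence its output, forever. -/
def stateAfter (A : CongestedCliqueAlgorithm n B Input Output) (input : Fin n → Input) :
    ℕ → Fin n → A.State
  | 0 => fun v => A.init v (input v)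
  | t + 1 => fun v =>
      if (A.output v (A.stateAfter input t v)).isSome then A.stateAfter input t v
      else A.update v (A.stateAfter input t v)
        (fun u => A.message u (A.stateAfter input t u) v)

/-- The output of node `v` after `t` rounds (`none` if `v` has not terminated yet). -/
def outputAfter (A : CongestedCliqueAlgorithm n B Input Output) (input : Fin n → Input)
    (t : ℕ) (v : Fin n) : Option Output :=
  A.output v (A.stateAfter input t v)

/-- After at most `t` rounds all nodes have terminated, each of them with the output `o`. -/
def AllOutputWithin (A : CongestedCliqueAlgorithm n B Input Output) (input : Fin n → Input)
    (t : ℕ) (o : Output) : Prop :=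
  ∀ v, A.outputAfter input t v = some o

end CongestedCliqueAlgorithm

/-! Four times the number of 4-cycles is the sum of C(codeg(u, v), 2) over ordered pairs u ≠ v
(`four_mul_copyCount_cycleGraph_four`), so it suffices that every u learns its codegrees, i.e. its
row of the squared adjacency matrix.

With a = `numParts` and c = ⌊n/a²⌋ = `numLayers`, the midpoints of 2-paths are split into c layers,
and for each layer the rows are split into a parts. Node (k, i, j) counts the 2-paths through layer
k between parts i and j. Dealing vertices out in order of decreasing degree balances all classes
(`sum_filter_balancedClass_le`), so a node needs about m/(ca) + n entries. Numbering the entries of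
a block and spreading them modulo n over all nodes lets them be delivered in O(m/(can) + 1) rounds
(`card_forwarded_le`). The counts return through relays in O(c) rounds (`card_relay_block_le`,
`relay_injective`). Taking a maximal with a² ≤ n and a³ · 2m ≤ n³ makes both costs O(m^(2/3)/n + 1).

Algorithms are handled through knowledge: `Attainable` records which instances a node can still
confuse. `Attainable.step` adds a communication phase, and `Attainable.exists_algorithm` turns the
final knowledge into an algorithm. -/

section Views

/-! ### Knowledge of nodes, and algorithms obtained from it. -/

variable {n B : ℕ} {Ω Input Output : Type}

/-- Node `v` cannot distinguish the instances `x` and `y` in its first `t` rounds, if `msg s x u v`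
is what `u` sends to `v` in round `s` on the instance `x`. -/
def SameView (inp : Ω → Fin n → Input) (msg : ℕ → Ω → Fin n → Fin n → Option (BitVec B)) (t : ℕ)
    (v : Fin n) (x y : Ω) : Prop :=
  inp x v = inp y v ∧ ∀ s < t, ∀ u, msg s x u v = msg s y u v

theorem SameView.symm {inp : Ω → Fin n → Input} {msg : ℕ → Ω → Fin n → Fin n → Option (BitVec B)}
    {t : ℕ} {v : Fin n} {x y : Ω} (h : SameView inp msg t v x y) : SameView inp msg t v y x :=
  ⟨h.1.symm, fun s hs u => (h.2 s hs u).symm⟩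

theorem SameView.mono {inp : Ω → Fin n → Input} {msg : ℕ → Ω → Fin n → Fin n → Option (BitVec B)}
    {s t : ℕ} {v : Fin n} {x y : Ω} (h : SameView inp msg t v x y) (hst : s ≤ t) :
    SameView inp msg s v x y :=
  ⟨h.1, fun r hr u => h.2 r (hr.trans_le hst) u⟩

/-- The messages that a node sends are a function of what it has seen so far. -/
def Causal (inp : Ω → Fin n → Input) (msg : ℕ → Ω → Fin n → Fin n → Option (BitVec B)) : Prop :=
  ∀ t v x y, SameView inp msg t v x y → ∀ w, msg t x v w = msg t y v w

/-- By messages of `B` bits, on every instance `x` all nodes can arrive after exactly `T x` rounds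
at a point where they know that `T x` rounds have passed, and where a node `v` for which `y` is
still possible has `R v x y`. -/
def Attainable (inp : Ω → Fin n → Input) (B : ℕ) (R : Fin n → Ω → Ω → Prop) (T : Ω → ℕ) : Prop :=
  ∃ msg : ℕ → Ω → Fin n → Fin n → Option (BitVec B), Causal inp msg ∧
    ∀ v x y, SameView inp msg (T x) v x y → T y = T x ∧ R v x y

theorem attainable_zero (inp : Ω → Fin n → Input) (B : ℕ) :
    Attainable inp B (fun v x y => inp x v = inp y v) (fun _ => 0) :=
  ⟨fun _ _ _ _ => none, fun _ _ _ _ _ _ => rfl, fun _ _ _ h => ⟨rfl, h.1⟩⟩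

theorem Attainable.mono {inp : Ω → Fin n → Input} {R R' : Fin n → Ω → Ω → Prop} {T : Ω → ℕ}
    (h : Attainable inp B R T) (hR : ∀ v x y, R v x y → R' v x y) : Attainable inp B R' T := by
  obtain ⟨msg, hc, hm⟩ := h
  exact ⟨msg, hc, fun v x y hv => ⟨(hm v x y hv).1, hR _ _ _ (hm v x y hv).2⟩⟩

theorem exists_injOn_bitVec {W : Type} (S : Finset W) (hS : S.card ≤ 2 ^ B) :
    ∃ f : W → BitVec B, Set.InjOn f S := by
  classical
  refine ⟨fun w => if h : w ∈ S then BitVec.ofFin ((S.equivFin ⟨w, h⟩).castLE hS) else 0, ?_⟩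
  intro w hw w' hw' h
  rw [Finset.mem_coe] at hw hw'
  simp only [hw, hw', dif_pos, BitVec.ofFin.injEq] at h
  have := S.equivFin.injective (Fin.castLE_injective hS h)
  simpa using this

/-- In the new phase u sends the elements of `M x u w` to w, one per round, encoded through `S`. By
`hM` and `hL` the sender knows what to send and every node knows when the phase ends. -/
theorem Attainable.step {inp : Ω → Fin n → Input} {R : Fin n → Ω → Ω → Prop} {T : Ω → ℕ}
    (h : Attainable inp B R T) {W : Type} (S : Finset W) (hS : S.card ≤ 2 ^ B)
    (M : Ω → Fin n → Fin n → Finset W) (L : Ω → ℕ)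
    (hMS : ∀ x u w, M x u w ⊆ S) (hML : ∀ x u w, (M x u w).card ≤ L x)
    (hM : ∀ u x y, R u x y → ∀ w, M x u w = M y u w) (hL : ∀ u x y, R u x y → L x = L y) :
    Attainable inp B (fun v x y => R v x y ∧ ∀ u, M x u v = M y u v) (fun x => T x + L x) := by
  classical
  obtain ⟨msg, hc, hm⟩ := h
  obtain ⟨f, hf⟩ := exists_injOn_bitVec S hS
  set msg' : ℕ → Ω → Fin n → Fin n → Option (BitVec B) := fun t x u w =>
    if t < T x then msg t x u w else ((M x u w).toList[t - T x]?).map f with hmsg'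
  have low : ∀ {t x u w}, t < T x → msg' t x u w = msg t x u w := fun h => if_pos h
  have high : ∀ {t x u w}, T x ≤ t → msg' t x u w = ((M x u w).toList[t - T x]?).map f :=
    fun h => if_neg h.not_gt
  have down : ∀ {t v x y}, SameView inp msg' t v x y → t ≤ T x → t ≤ T y →
      SameView inp msg t v x y := fun {t v x y} h hx hy => ⟨h.1, fun s hs u => by
    rw [← low (hs.trans_le hx), ← low (hs.trans_le hy), h.2 s hs u]⟩
  -- Instances that look alike are in the same phase, since at the end of the old phase a node knows
  -- that it has ended.
  have key : ∀ {t v x y}, SameView inp msg' t v x y →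
      (t < T x ∧ t < T y ∧ SameView inp msg t v x y) ∨ (T x ≤ t ∧ T y = T x ∧ R v x y) := by
    intro t v x y h
    rcases le_total (T x) (T y) with hxy | hxy
    · by_cases ht : T x ≤ t
      · exact .inr ⟨ht, hm _ _ _ (down (h.mono ht) le_rfl hxy)⟩
      · have : t < T x := not_le.1 ht
        exact .inl ⟨this, by omega, down h (by omega) (by omega)⟩
    · by_cases ht : T y ≤ t
      · have e := (hm _ _ _ (down (h.symm.mono ht) le_rfl hxy)).1
        exact .inr ⟨by omega, hm _ _ _ (down (h.mono (by omega)) le_rfl (by omega))⟩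
      · have : t < T y := not_le.1 ht
        exact .inl ⟨by omega, this, down h (by omega) (by omega)⟩
  refine ⟨msg', ?_, ?_⟩
  · intro t v x y h w
    rcases key h with ⟨hx, hy, hv⟩ | ⟨hx, hy, hr⟩
    · rw [low hx, low hy, hc t v x y hv]
    -- Equal sets have the same `toList`, so the order of sending is known too.
    · rw [high hx, high (hy ▸ hx), hM v x y hr w, hy]
  · intro v x y h
    beta_reduce at h ⊢
    rcases key h with ⟨hx, -⟩ | ⟨-, hy, hr⟩
    · omega
    have hLe := hL _ _ _ hr
    refine ⟨by rw [hy, hLe], hr, fun u => ?_⟩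
    have e : (M x u v).toList.map f = (M y u v).toList.map f := by
      refine List.ext_getElem? fun j => ?_
      by_cases hj : j < L x
      · have := h.2 (T x + j) (by omega) u
        rw [high (by omega), high (by omega), hy, Nat.add_sub_cancel_left] at this
        simpa using this
      · have h1 := hML x u v
        have h2 := hML y u v
        rw [List.getElem?_eq_none (by simp; omega), List.getElem?_eq_none (by simp; omega)]
    have e' : (M x u v).image f = (M y u v).image f := by
      ext b
      simpa using congrArg (b ∈ ·) e
    apply Finset.coe_injective
    have e2 : f '' (M x u v) = f '' (M y u v) := by
      rw [← Finset.coe_image, ← Finset.coe_image, e']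
    exact hf.image_eq_image_iff (by exact_mod_cast hMS x u v) (by exact_mod_cast hMS y u v) |>.1 e2

/-- A node remembers its whole history and acts as on an arbitrary instance consistent with it;
causality makes the choice irrelevant. -/
theorem Attainable.exists_algorithm {inp : Ω → Fin n → Input} {R : Fin n → Ω → Ω → Prop}
    {T : Ω → ℕ} (h : Attainable inp B R T) (out : Ω → Output)
    (hout : ∀ v x y, R v x y → out x = out y) :
    ∃ A : CongestedCliqueAlgorithm n B Input Output,
      ∀ x, A.AllOutputWithin (inp x) (T x) (out x) := by
  classical
  obtain ⟨msg, hc, hm⟩ := h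
  -- A state holds the input, the number of rounds that have passed and the messages received.
  let Consistent (v : Fin n) (s : Input × ℕ × (ℕ → Fin n → Option (BitVec B))) (y : Ω) : Prop :=
    inp y v = s.1 ∧ ∀ r < s.2.1, ∀ u, s.2.2 r u = msg r y u v
  let A : CongestedCliqueAlgorithm n B Input Output :=
    { State := Input × ℕ × (ℕ → Fin n → Option (BitVec B))
      init := fun _ i => (i, 0, fun _ _ => none)
      send := fun v s w => if h : ∃ y, Consistent v s y then msg s.2.1 h.choose v w else none
      update := fun _ s m => (s.1, s.2.1 + 1, Function.update s.2.2 s.2.1 m)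
      output := fun v s =>
        if h : ∃ y, Consistent v s y ∧ T y ≤ s.2.1 then some (out h.choose) else none }
  let st (x : Ω) (t : ℕ) (v : Fin n) : A.State :=
    (inp x v, t, fun r u => if r < t then msg r x u v else none)
  have hcons : ∀ x t v y, Consistent v (st x t v) y ↔ SameView inp msg t v x y := by
    intro x t v y
    constructor
    · rintro ⟨h1, h2⟩
      refine ⟨h1.symm, fun s hs u => ?_⟩
      have := h2 s hs u
      simpa [st, hs] using this
    · rintro ⟨h1, h2⟩
      refine ⟨h1.symm, fun s hs u => ?_⟩
      have hs' : s < t := hs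
      simpa [st, hs'] using h2 s hs u
  have hrefl : ∀ x t v, Consistent v (st x t v) x := fun x t v =>
    (hcons x t v x).2 ⟨rfl, fun _ _ _ => rfl⟩
  -- Early termination would silence a node. It is excluded because a consistent `y` with `T y ≤ t`
  -- would force `T x = T y`.
  have hnone : ∀ x t v, t < T x → A.output v (st x t v) = none := by
    intro x t v ht
    refine dif_neg ?_
    rintro ⟨y, hy, hyt⟩
    have hyt' : T y ≤ t := hyt
    have := (hm v y x (((hcons x t v y).1 hy).symm.mono hyt')).1
    omega
  have hsend : ∀ x t v w, A.send v (st x t v) w = msg t x v w := by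
    intro x t v w
    have hex : ∃ y, Consistent v (st x t v) y := ⟨x, hrefl x t v⟩
    have : A.send v (st x t v) w = msg t hex.choose v w := dif_pos hex
    rw [this]
    exact (hc t v x _ ((hcons x t v _).1 hex.choose_spec) w).symm
  have hst : ∀ x t, t ≤ T x → A.stateAfter (inp x) t = st x t := by
    intro x t
    induction t with
    | zero => intro _; funext v; simp [CongestedCliqueAlgorithm.stateAfter, st, A]
    | succ t ih =>
      intro ht
      have ih := ih (by omega)
      funext v
      rw [CongestedCliqueAlgorithm.stateAfter, ih]
      beta_reduce
      rw [hnone x t v (by omega)]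
      have : (fun u => A.message u (st x t u) v) = fun u => msg t x u v := by
        funext u
        simp [CongestedCliqueAlgorithm.message, hnone x t u (by omega), hsend]
      simp only [Option.isSome_none, Bool.false_eq_true, if_false]
      rw [this]
      simp only [A, st, Prod.mk.injEq, true_and]
      funext r u
      by_cases hr : r = t
      · subst hr; simp
      · rw [Function.update_of_ne hr]
        have : r < t + 1 ↔ r < t := by omega
        simp [this]
  refine ⟨A, fun x v => ?_⟩
  rw [CongestedCliqueAlgorithm.outputAfter, hst x _ le_rfl]
  have hex : ∃ y, Consistent v (st x (T x) v) y ∧ T y ≤ (st x (T x) v).2.1 :=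
    ⟨x, hrefl x _ v, le_rfl⟩
  have : A.output v (st x (T x) v) = some (out hex.choose) := dif_pos hex
  rw [this, hout v x _ (hm v x _ ((hcons x _ v _).1 hex.choose_spec.1)).2]

end Views

/-! ### Balanced partitions. -/

section Balance

variable {n : ℕ}

/-- The position of `v` when the nodes are sorted by decreasing values of `f`. -/
def descendingRank (f : Fin n → ℕ) : Equiv.Perm (Fin n) :=
  (Tuple.sort (fun v => OrderDual.toDual (f v))).symm

theorem antitone_comp_descendingRank_symm (f : Fin n → ℕ) :
    Antitone (f ∘ (descendingRank f).symm) := by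
  intro i j hij
  exact Tuple.monotone_sort (fun v => OrderDual.toDual (f v)) hij

/-- The nodes are dealt out into `q` classes, in the order of decreasing values of `f`. -/
def balancedClass (f : Fin n → ℕ) (q : ℕ) (v : Fin n) : ℕ :=
  (descendingRank f v : ℕ) % q

/-- Apart from its first term, class i is dominated termwise by class j shifted by one, because j +
tq ≤ i + (t + 1)q. -/
theorem sum_residue_le {g : ℕ → ℕ} (hg : Antitone g) {q i j : ℕ} (hj : j < q) :
    ∑ t ∈ Finset.range n, g (i + t * q) ≤ (∑ t ∈ Finset.range n, g (j + t * q)) + g 0 := by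
  have h1 : ∑ t ∈ Finset.range (n + 1), g (i + t * q) =
      (∑ t ∈ Finset.range n, g (i + (t + 1) * q)) + g (i + 0 * q) :=
    Finset.sum_range_succ' _ _
  have h2 : ∑ t ∈ Finset.range n, g (i + t * q) ≤ ∑ t ∈ Finset.range (n + 1), g (i + t * q) :=
    Finset.sum_le_sum_of_subset (by simp)
  have h3 : ∑ t ∈ Finset.range n, g (i + (t + 1) * q) ≤ ∑ t ∈ Finset.range n, g (j + t * q) :=
    Finset.sum_le_sum fun t _ => hg (by nlinarith)
  have h4 : g (i + 0 * q) ≤ g 0 := hg (by omega)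
  omega

/-- Any two class sums differ by at most `F`; compare class i with all q classes and add up. -/
theorem sum_filter_balancedClass_le (f : Fin n → ℕ) {F q : ℕ} (hF : ∀ v, f v ≤ F) {i : ℕ}
    (hi : i < q) :
    q * ∑ v with balancedClass f q v = i, f v ≤ (∑ v, f v) + q * F := by
  classical
  set g : ℕ → ℕ := fun x => if h : x < n then f ((descendingRank f).symm ⟨x, h⟩) else 0 with hgdef
  have hgval : ∀ v, g (descendingRank f v) = f v := fun v => by simp [hgdef]
  have hg : Antitone g := by
    intro x y hxy
    by_cases hy : y < n
    · have hx : x < n := by omega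
      simp only [hgdef, hx, hy, dif_pos]
      exact antitone_comp_descendingRank_symm f (show (⟨x, hx⟩ : Fin n) ≤ ⟨y, hy⟩ from hxy)
    · simp [hgdef, hy]
  have hn : ∀ x, n ≤ x → g x = 0 := fun x hx => by simp [hgdef, hx.not_gt]
  have hg0 : g 0 ≤ F := by
    by_cases h : 0 < n
    · simp only [hgdef, h, dif_pos]; exact hF _
    · simp [hgdef, h]
  have hclass : ∀ j < q, ∑ v with balancedClass f q v = j, f v =
      ∑ t ∈ Finset.range n, g (j + t * q) := by
    intro j hj
    rw [← Finset.sum_filter_of_ne (s := Finset.range n) (p := fun t => j + t * q < n)]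
    · refine Finset.sum_bij (fun v _ => (descendingRank f v : ℕ) / q) ?_ ?_ ?_ ?_
      · intro v hv
        have hv : (descendingRank f v : ℕ) % q = j := (Finset.mem_filter.1 hv).2
        have h1 := Nat.mod_add_div (descendingRank f v : ℕ) q
        have h2 := (descendingRank f v).isLt
        have h3 : (descendingRank f v : ℕ) / q ≤ descendingRank f v := Nat.div_le_self _ _
        simp only [Finset.mem_filter, Finset.mem_range]
        refine ⟨by omega, ?_⟩
        rw [mul_comm, ← hv, h1]; exact h2
      · intro v hv w hw h
        have hv : (descendingRank f v : ℕ) % q = j := (Finset.mem_filter.1 hv).2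
        have hw : (descendingRank f w : ℕ) % q = j := (Finset.mem_filter.1 hw).2
        have h1 := Nat.mod_add_div (descendingRank f v : ℕ) q
        have h2 := Nat.mod_add_div (descendingRank f w : ℕ) q
        apply (descendingRank f).injective
        apply Fin.ext
        rw [← h1, ← h2, hv, hw, h]
      · intro t ht
        simp only [Finset.mem_filter, Finset.mem_range] at ht
        refine ⟨(descendingRank f).symm ⟨j + t * q, ht.2⟩, ?_, ?_⟩
        · rw [Finset.mem_filter]; simp [balancedClass, Nat.mod_eq_of_lt hj]
        · simp [Nat.add_mul_div_right _ _ (by omega : 0 < q), Nat.div_eq_of_lt hj]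
      · intro v hv
        have hv : (descendingRank f v : ℕ) % q = j := (Finset.mem_filter.1 hv).2
        rw [mul_comm, ← hv, Nat.mod_add_div, hgval]
    · intro t _ h
      by_contra h'
      exact h (hn _ (by omega))
  have htot : ∑ v, f v = ∑ j ∈ Finset.range q, ∑ v with balancedClass f q v = j, f v :=
    (Finset.sum_fiberwise_of_maps_to
      (fun v _ => Finset.mem_range.2 (Nat.mod_lt _ (by omega))) _).symm
  calc q * ∑ v with balancedClass f q v = i, f v
      = ∑ j ∈ Finset.range q, ∑ v with balancedClass f q v = i, f v := by simp
    _ ≤ ∑ j ∈ Finset.range q, ((∑ v with balancedClass f q v = j, f v) + F) := by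
        refine Finset.sum_le_sum fun j hj => ?_
        rw [hclass i hi, hclass j (Finset.mem_range.1 hj)]
        exact (sum_residue_le hg (Finset.mem_range.1 hj)).trans (by omega)
    _ = _ := by rw [Finset.sum_add_distrib, ← htot]; simp

end Balance

/-! ### Counting 4-cycles by codegrees. -/

open scoped Classical in
/-- The number of common neighbours of `u` and `v`. -/
noncomputable def codegree {n : ℕ} (G : SimpleGraph (Fin n)) (u v : Fin n) : ℕ :=
  Finset.card {w | G.Adj u w ∧ G.Adj v w}

theorem card_automorphisms_cycleGraph_four :
    Nat.card (SimpleGraph.cycleGraph 4 ≃g SimpleGraph.cycleGraph 4) = 8 := by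
  have e : (SimpleGraph.cycleGraph 4 ≃g SimpleGraph.cycleGraph 4) ≃
      {σ : Equiv.Perm (Fin 4) // ∀ i j, (SimpleGraph.cycleGraph 4).Adj (σ i) (σ j) ↔
        (SimpleGraph.cycleGraph 4).Adj i j} :=
    { toFun := fun f => ⟨f.toEquiv, fun i j => f.map_rel_iff⟩
      invFun := fun f => ⟨f.1, fun {i j} => f.2 i j⟩
      left_inv := fun f => rfl
      right_inv := fun f => rfl }
  rw [Nat.card_congr e, Nat.card_eq_fintype_card]
  decide +kernel

theorem coeCopy_comp_toCopy_toSubgraph {V W : Type*} {G : SimpleGraph V} {H : SimpleGraph W}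
    (G' : G.Subgraph) (e : H ≃g G'.coe) : (G'.coeCopy.comp e.toCopy).toSubgraph = G' := by
  have hval : ∀ a, (G'.coeCopy.comp e.toCopy) a = (e a : V) := fun a => rfl
  ext a b
  · simp only [SimpleGraph.Copy.toSubgraph, SimpleGraph.Subgraph.map_verts,
      SimpleGraph.Subgraph.verts_top, Set.image_univ, Set.mem_range]
    constructor
    · rintro ⟨x, rfl⟩; exact (e x).2
    · intro ha; exact ⟨e.symm ⟨a, ha⟩, congrArg Subtype.val (e.apply_symm_apply ⟨a, ha⟩)⟩
  · simp only [SimpleGraph.Copy.toSubgraph, SimpleGraph.Subgraph.map_adj, Relation.Map,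
      SimpleGraph.Subgraph.top_adj]
    constructor
    · rintro ⟨x, y, hxy, rfl, rfl⟩
      exact e.map_rel_iff.2 hxy
    · intro h
      refine ⟨e.symm ⟨a, h.fst_mem⟩, e.symm ⟨b, h.snd_mem⟩, ?_, ?_, ?_⟩
      · exact e.symm.map_rel_iff.2 (show G'.coe.Adj ⟨a, h.fst_mem⟩ ⟨b, h.snd_mem⟩ from h)
      · exact congrArg Subtype.val (e.apply_symm_apply ⟨a, h.fst_mem⟩)
      · exact congrArg Subtype.val (e.apply_symm_apply ⟨b, h.snd_mem⟩)

/-- A copy is a subgraph together with an isomorphism from `H` onto it, and these isomorphisms form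
a torsor under the automorphisms of `H`. -/
theorem card_copy_eq_mul_copyCount {V W : Type*} [Fintype V] [Finite W] (G : SimpleGraph V)
    (H : SimpleGraph W) :
    Nat.card (H.Copy G) = G.copyCount H * Nat.card (H ≃g H) := by
  classical
  let X := {G' : G.Subgraph // Nonempty (H ≃g G'.coe)}
  let φ : (Σ p : X, (H ≃g p.1.coe)) → H.Copy G := fun p => p.1.1.coeCopy.comp p.2.toCopy
  have hφ : Function.Bijective φ := by
    constructor
    · rintro ⟨⟨G₁, h₁⟩, e₁⟩ ⟨⟨G₂, h₂⟩, e₂⟩ h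
      have hG : G₁ = G₂ := by
        rw [← coeCopy_comp_toCopy_toSubgraph G₁ e₁, ← coeCopy_comp_toCopy_toSubgraph G₂ e₂]
        exact congrArg SimpleGraph.Copy.toSubgraph h
      subst hG
      have : e₁ = e₂ := by
        ext a
        exact DFunLike.congr_fun h a
      rw [this]
    · intro f
      refine ⟨⟨⟨f.toSubgraph, ⟨f.isoToSubgraph⟩⟩, f.isoToSubgraph⟩, ?_⟩
      ext a
      rfl
  have hX : Nat.card X = G.copyCount H := by
    rw [SimpleGraph.copyCount, Nat.card_eq_fintype_card, Fintype.card_subtype]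
  have hfib : ∀ p : X, Nat.card (H ≃g p.1.coe) = Nat.card (H ≃g H) := by
    rintro ⟨G', ⟨e₀⟩⟩
    refine Nat.card_congr ⟨fun e => e.trans e₀.symm, fun e => e.trans e₀, ?_, ?_⟩
    · intro e; ext a; simp
    · intro e; ext a; simp
  have : ∀ p : X, Finite (H ≃g p.1.coe) := fun p =>
    Finite.of_injective (fun e => (e : W → p.1.verts)) DFunLike.coe_injective
  rw [← Nat.card_congr (Equiv.ofBijective φ hφ), Nat.card_sigma, Finset.sum_congr rfl
    (fun p _ => hfib p), Finset.sum_const, smul_eq_mul, ← hX, Finset.card_univ,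
    Nat.card_eq_fintype_card (α := X)]

open scoped Classical in
theorem card_copy_cycleGraph_four {n : ℕ} (G : SimpleGraph (Fin n)) :
    Nat.card ((SimpleGraph.cycleGraph 4).Copy G) =
      ∑ u, ∑ v ∈ Finset.univ.erase u, codegree G u v * (codegree G u v - 1) := by
  have adj : ∀ i : Fin 4, (SimpleGraph.cycleGraph 4).Adj i (i + 1) := by decide
  have adj' : ∀ i : Fin 4, (SimpleGraph.cycleGraph 4).Adj i (i - 1) := by decide
  have hadj : ∀ i j : Fin 4, (SimpleGraph.cycleGraph 4).Adj i j → j = i + 1 ∨ j = i - 1 := by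
    decide
  let N (u v : Fin n) : Finset (Fin n) := {w | G.Adj u w ∧ G.Adj v w}
  have hN : ∀ {u v w}, w ∈ N u v ↔ G.Adj u w ∧ G.Adj v w := by simp [N]
  let s : Finset (Σ _ : Fin n, Σ _ : Fin n, Fin n × Fin n) :=
    Finset.univ.sigma fun u => (Finset.univ.erase u).sigma fun v => (N u v).offDiag
  have hs : s.card = ∑ u, ∑ v ∈ Finset.univ.erase u, codegree G u v * (codegree G u v - 1) := by
    simp only [s, Finset.card_sigma, Finset.offDiag_card, Nat.mul_sub, mul_one]
    rfl
  rw [← hs, Nat.card_eq_fintype_card, ← Finset.card_univ]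
  -- A labelled 4-cycle is an ordered pair of opposite vertices with an ordered pair of distinct
  -- common neighbours.
  refine Finset.card_bij (fun f _ => ⟨f 0, f 2, f 1, f 3⟩) ?_ ?_ ?_
  · intro f _
    have hf : ∀ i j, i ≠ j → f i ≠ f j := fun i j h => f.injective.ne h
    have ha : ∀ i j, (SimpleGraph.cycleGraph 4).Adj i j → G.Adj (f i) (f j) :=
      fun i j h => f.toHom.map_adj h
    simp only [s, Finset.mem_sigma, Finset.mem_univ, true_and, Finset.mem_erase, and_true,
      Finset.mem_offDiag, hN]
    exact ⟨hf 2 0 (by decide), ⟨ha 0 1 (by decide), ha 2 1 (by decide)⟩,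
      ⟨ha 0 3 (by decide), ha 2 3 (by decide)⟩, hf 1 3 (by decide)⟩
  · intro f _ g _ h
    simp only [Sigma.mk.injEq, heq_eq_eq, Prod.mk.injEq] at h
    ext a
    fin_cases a
    exacts [congrArg _ h.1, congrArg _ h.2.2.1, congrArg _ h.2.1, congrArg _ h.2.2.2]
  · rintro ⟨u, v, w, w'⟩ h
    simp only [s, Finset.mem_sigma, Finset.mem_univ, true_and, Finset.mem_erase, and_true,
      Finset.mem_offDiag, hN] at h
    obtain ⟨hvu, ⟨huw, hvw⟩, ⟨huw', hvw'⟩, hww'⟩ := h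
    let f : Fin 4 → Fin n := ![u, w, v, w']
    have h1 : ∀ i, G.Adj (f i) (f (i + 1)) := by
      intro i
      fin_cases i
      exacts [huw, hvw.symm, hvw', huw'.symm]
    have h2 : ∀ i j, (SimpleGraph.cycleGraph 4).Adj i j → G.Adj (f i) (f j) := by
      intro i j hij
      rcases hadj i j hij with rfl | rfl
      · exact h1 i
      · have := h1 (i - 1)
        rw [sub_add_cancel] at this
        exact this.symm
    have hinj : Function.Injective f := by
      intro i j hij
      by_contra hne
      by_cases hij' : (SimpleGraph.cycleGraph 4).Adj i j
      · exact (h2 i j hij').ne hij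
      · have : ∀ i j : Fin 4, i ≠ j → ¬ (SimpleGraph.cycleGraph 4).Adj i j →
            (i = 0 ∧ j = 2) ∨ (i = 2 ∧ j = 0) ∨ (i = 1 ∧ j = 3) ∨ (i = 3 ∧ j = 1) := by decide
        rcases this i j hne hij' with ⟨rfl, rfl⟩ | ⟨rfl, rfl⟩ | ⟨rfl, rfl⟩ | ⟨rfl, rfl⟩
        exacts [hvu hij.symm, hvu hij, hww' hij, hww' hij.symm]
    exact ⟨⟨⟨f, fun {i j} h => h2 i j h⟩, hinj⟩, Finset.mem_univ _, rfl⟩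

theorem four_mul_copyCount_cycleGraph_four {n : ℕ} (G : SimpleGraph (Fin n)) :
    4 * G.copyCount (SimpleGraph.cycleGraph 4) =
      ∑ u, ∑ v ∈ Finset.univ.erase u, (codegree G u v).choose 2 := by
  have h := card_copy_eq_mul_copyCount G (SimpleGraph.cycleGraph 4)
  rw [card_automorphisms_cycleGraph_four, card_copy_cycleGraph_four] at h
  have : ∀ m : ℕ, m * (m - 1) = 2 * m.choose 2 := fun m => by
    rw [Nat.choose_two_right, Nat.mul_div_cancel' (Nat.even_mul_pred_self m).two_dvd]
  simp only [this, ← Finset.mul_sum] at h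
  omega

/-! ### Layers, parts, and the load of every link. -/

section FourCycles

open scoped Classical

variable {n : ℕ}

noncomputable def neighbors (G : SimpleGraph (Fin n)) (v : Fin n) : Finset (Fin n) :=
  {w | G.Adj v w}

@[simp]
theorem mem_neighbors {G : SimpleGraph (Fin n)} {v w : Fin n} :
    w ∈ neighbors G v ↔ G.Adj v w := by
  simp [neighbors]

noncomputable def degrees (G : SimpleGraph (Fin n)) (v : Fin n) : ℕ :=
  (neighbors G v).card

theorem degrees_lt (G : SimpleGraph (Fin n)) (v : Fin n) : degrees G v < n := by
  have : neighbors G v ⊂ Finset.univ :=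
    Finset.ssubset_univ_iff.2 fun h => by
      have : v ∈ neighbors G v := h ▸ Finset.mem_univ v
      simp at this
  simpa [degrees] using Finset.card_lt_card this

theorem sum_degrees_le (G : SimpleGraph (Fin n)) : ∑ v, degrees G v ≤ n ^ 2 := by
  calc ∑ v, degrees G v ≤ ∑ _v : Fin n, n := Finset.sum_le_sum fun v _ => (degrees_lt G v).le
    _ = n ^ 2 := by simp [sq]

/-- The number of parts into which every layer splits the rows (and the columns) of the squared
adjacency matrix. -/
def numParts (d : Fin n → ℕ) : ℕ :=
  Nat.findGreatest (fun a => a ^ 2 ≤ n ∧ a ^ 3 * ∑ v, d v ≤ n ^ 3) n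

/-- The number of layers: one layer has `numParts d ^ 2` nodes. -/
def numLayers (d : Fin n → ℕ) : ℕ :=
  n / numParts d ^ 2

theorem numParts_spec (hn : 0 < n) {d : Fin n → ℕ} (hd : ∑ v, d v ≤ n ^ 2) :
    0 < numParts d ∧ numParts d ^ 2 ≤ n ∧ numParts d ^ 3 * ∑ v, d v ≤ n ^ 3 := by
  have h1 : (1 : ℕ) ^ 2 ≤ n ∧ 1 ^ 3 * ∑ v, d v ≤ n ^ 3 :=
    ⟨by omega, by
      rw [one_pow, one_mul]
      exact hd.trans (Nat.pow_le_pow_right hn (by norm_num))⟩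
  exact ⟨Nat.le_findGreatest (P := fun a => a ^ 2 ≤ n ∧ a ^ 3 * ∑ v, d v ≤ n ^ 3) hn h1,
    Nat.findGreatest_spec (P := fun a => a ^ 2 ≤ n ∧ a ^ 3 * ∑ v, d v ≤ n ^ 3) hn h1⟩

theorem numParts_maximal (d : Fin n → ℕ) :
    n < (numParts d + 1) ^ 2 ∨ n ^ 3 < (numParts d + 1) ^ 3 * ∑ v, d v := by
  by_contra! h
  -- The search bound n in `numParts` is harmless, as a² ≤ n implies a ≤ n.
  have h1 : numParts d + 1 ≤ n := by nlinarith [h.1]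
  exact Nat.findGreatest_is_greatest (P := fun a => a ^ 2 ≤ n ∧ a ^ 3 * ∑ v, d v ≤ n ^ 3)
    (Nat.lt_succ_self _) h1 h

theorem numParts_pos (G : SimpleGraph (Fin n)) (hn : 0 < n) : 0 < numParts (degrees G) :=
  (numParts_spec hn (sum_degrees_le G)).1

theorem sq_numParts_le (G : SimpleGraph (Fin n)) (hn : 0 < n) :
    numParts (degrees G) ^ 2 ≤ n :=
  (numParts_spec hn (sum_degrees_le G)).2.1

theorem numLayers_pos (G : SimpleGraph (Fin n)) (hn : 0 < n) : 0 < numLayers (degrees G) :=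
  Nat.div_pos (sq_numParts_le G hn) (pow_pos (numParts_pos G hn) 2)

theorem numLayers_le (d : Fin n → ℕ) : numLayers d ≤ n := Nat.div_le_self _ _

/-- The layer that is responsible for the 2-paths through `w`. -/
def layer (d : Fin n → ℕ) (w : Fin n) : ℕ := balancedClass d (numLayers d) w

theorem layer_lt (G : SimpleGraph (Fin n)) (hn : 0 < n) (w : Fin n) :
    layer (degrees G) w < numLayers (degrees G) :=
  Nat.mod_lt _ (numLayers_pos G hn)

noncomputable def layerNeighbors (G : SimpleGraph (Fin n)) (k : ℕ) (v : Fin n) :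
    Finset (Fin n) :=
  {w ∈ neighbors G v | layer (degrees G) w = k}

@[simp]
theorem mem_layerNeighbors {G : SimpleGraph (Fin n)} {k : ℕ} {v w : Fin n} :
    w ∈ layerNeighbors G k v ↔ G.Adj v w ∧ layer (degrees G) w = k := by
  simp [layerNeighbors]

noncomputable def layerDegrees (G : SimpleGraph (Fin n)) (k : ℕ) (v : Fin n) : ℕ :=
  (layerNeighbors G k v).card

theorem layerDegrees_lt (G : SimpleGraph (Fin n)) (k : ℕ) (v : Fin n) : layerDegrees G k v < n :=
  (Finset.card_filter_le _ _).trans_lt (degrees_lt G v)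

theorem layerDegrees_eq_zero (G : SimpleGraph (Fin n)) (hn : 0 < n) {k : ℕ}
    (hk : numLayers (degrees G) ≤ k) (v : Fin n) : layerDegrees G k v = 0 := by
  rw [layerDegrees, Finset.card_eq_zero, Finset.eq_empty_iff_forall_notMem]
  intro w hw
  have := layer_lt G hn w
  have := (mem_layerNeighbors.1 hw).2
  omega

theorem sum_card_filter_neighbors (G : SimpleGraph (Fin n)) (p : Fin n → Prop)
    [DecidablePred p] : ∑ v, Finset.card {w ∈ neighbors G v | p w} = ∑ w with p w, degrees G w := by
  have h : ∀ w, degrees G w = ∑ v, if G.Adj v w then 1 else 0 := fun w => by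
    simp [degrees, neighbors, G.adj_comm]
  simp only [h, neighbors, Finset.filter_filter, Finset.card_filter]
  rw [Finset.sum_comm, Finset.sum_filter]
  refine Finset.sum_congr rfl fun w _ => ?_
  by_cases hw : p w <;> simp [hw]

theorem sum_layerDegrees (G : SimpleGraph (Fin n)) (k : ℕ) :
    ∑ v, layerDegrees G k v = ∑ w with layer (degrees G) w = k, degrees G w :=
  sum_card_filter_neighbors G fun w => layer (degrees G) w = k

/-- The part of the rows (and of the columns) that contains `v` in layer `k`. -/
noncomputable def part (G : SimpleGraph (Fin n)) (k : ℕ) (v : Fin n) : ℕ :=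
  balancedClass (layerDegrees G k) (numParts (degrees G)) v

theorem part_lt (G : SimpleGraph (Fin n)) (hn : 0 < n) (k : ℕ) (v : Fin n) :
    part G k v < numParts (degrees G) :=
  Nat.mod_lt _ (numParts_pos G hn)

/-- An upper bound, known to all nodes, on the number of nonzero entries of a block. -/
def blockBound (d : Fin n → ℕ) : ℕ :=
  ((∑ v, d v) / numLayers d + n) / numParts d + n

/-- Balance is used twice: for the layers, then for the parts of one layer. Layers beyond the last
are empty; they are allowed because n need not be a multiple of a², which leaves spare nodes. -/
theorem sum_part_le (G : SimpleGraph (Fin n)) (hn : 0 < n) (k : ℕ) {i : ℕ}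
    (hi : i < numParts (degrees G)) :
    ∑ v with part G k v = i, layerDegrees G k v ≤ blockBound (degrees G) := by
  have h1 := sum_filter_balancedClass_le (layerDegrees G k)
    (fun v => (layerDegrees_lt G k v).le) hi
  have hs : ∑ v, layerDegrees G k v ≤ (∑ v, degrees G v) / numLayers (degrees G) + n := by
    by_cases hk : k < numLayers (degrees G)
    · have h2 := sum_filter_balancedClass_le (degrees G) (fun v => (degrees_lt G v).le) hk
      rw [sum_layerDegrees, ← Nat.add_mul_div_left _ _ (numLayers_pos G hn),
        Nat.le_div_iff_mul_le (numLayers_pos G hn), mul_comm]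
      exact h2
    · simp [layerDegrees_eq_zero G hn (not_lt.1 hk)]
  rw [blockBound, ← Nat.add_mul_div_left _ _ (numParts_pos G hn),
    Nat.le_div_iff_mul_le (numParts_pos G hn), mul_comm]
  exact h1.trans (by omega)

/-- The number of nonzero entries in the rows before `v` in the block of `v`, if `v` has `D v`
nonzero entries and the rows are split into `a` parts. -/
def blockOffset (D : Fin n → ℕ) (a : ℕ) (v : Fin n) : ℕ :=
  ∑ u with u < v ∧ balancedClass D a u = balancedClass D a v, D u

/-- The number of an entry `(v, w)` of the adjacency matrix within its block. -/
noncomputable def slot (G : SimpleGraph (Fin n)) (v w : Fin n) : ℕ :=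
  blockOffset (layerDegrees G (layer (degrees G) w)) (numParts (degrees G)) v +
    Finset.card {w' ∈ layerNeighbors G (layer (degrees G) w) v | w' < w}

theorem card_lt_layerDegrees {G : SimpleGraph (Fin n)} {k : ℕ} {v w : Fin n}
    (h : w ∈ layerNeighbors G k v) :
    Finset.card {w' ∈ layerNeighbors G k v | w' < w} < layerDegrees G k v :=
  Finset.card_lt_card (Finset.filter_ssubset.2 ⟨w, h, lt_irrefl w⟩)

theorem card_filter_lt_injOn (s : Finset (Fin n)) :
    Set.InjOn (fun w => Finset.card {w' ∈ s | w' < w}) s := by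
  have aux : ∀ w ∈ s, ∀ w', w < w' →
      Finset.card {x ∈ s | x < w} < Finset.card {x ∈ s | x < w'} := by
    intro w hw w' h
    refine Finset.card_lt_card (Finset.ssubset_iff_of_subset ?_ |>.2 ⟨w, ?_, ?_⟩)
    · intro x hx
      simp only [Finset.mem_filter] at hx ⊢
      exact ⟨hx.1, hx.2.trans h⟩
    · simp [hw, h]
    · simp
  intro w hw w' hw' h
  by_contra hne
  rcases lt_or_gt_of_ne hne with hlt | hlt
  · exact (aux w hw w' hlt).ne h
  · exact (aux w' hw' w hlt).ne h.symm

theorem blockOffset_add_le {D : Fin n → ℕ} {a : ℕ} {u v : Fin n} (huv : u < v)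
    (h : balancedClass D a u = balancedClass D a v) :
    blockOffset D a u + D u ≤ blockOffset D a v := by
  rw [blockOffset, add_comm, ← Finset.sum_insert (by simp)]
  refine Finset.sum_le_sum_of_subset fun x hx => ?_
  simp only [Finset.mem_insert, Finset.mem_filter, Finset.mem_univ, true_and] at hx ⊢
  rcases hx with rfl | hx
  · exact ⟨huv, h⟩
  · exact ⟨hx.1.trans huv, hx.2.trans h⟩

theorem blockOffset_add_le_sum {D : Fin n → ℕ} {a : ℕ} (v : Fin n) :
    blockOffset D a v + D v ≤ ∑ u with balancedClass D a u = balancedClass D a v, D u := by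
  rw [blockOffset, add_comm, ← Finset.sum_insert (by simp)]
  refine Finset.sum_le_sum_of_subset fun x hx => ?_
  simp only [Finset.mem_insert, Finset.mem_filter, Finset.mem_univ, true_and] at hx ⊢
  rcases hx with rfl | hx
  · rfl
  · exact hx.2

/-- The entries of the block in layer `k` and part `i`. -/
noncomputable def block (G : SimpleGraph (Fin n)) (k i : ℕ) : Finset (Fin n × Fin n) :=
  {e | G.Adj e.1 e.2 ∧ layer (degrees G) e.2 = k ∧ part G k e.1 = i}

/-- Within a block the rows occupy disjoint intervals of slots, in increasing order. -/
theorem slot_injOn_block (G : SimpleGraph (Fin n)) (k i : ℕ) :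
    Set.InjOn (fun e : Fin n × Fin n => slot G e.1 e.2) (block G k i) := by
  have aux : ∀ v w v' w', (v, w) ∈ block G k i → (v', w') ∈ block G k i → v < v' →
      slot G v w < slot G v' w' := by
    intro v w v' w' h h' hlt
    simp only [block, Finset.mem_filter, Finset.mem_univ, true_and] at h h'
    have h1 := card_lt_layerDegrees (mem_layerNeighbors.2 ⟨h.1, h.2.1⟩)
    have h2 := blockOffset_add_le hlt (h.2.2.trans h'.2.2.symm)
    rw [slot, slot, h.2.1, h'.2.1]
    omega
  rintro ⟨v, w⟩ h ⟨v', w'⟩ h' heq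
  simp only at heq
  rcases lt_trichotomy v v' with hlt | rfl | hlt
  · exact absurd heq (aux _ _ _ _ h h' hlt).ne
  · simp only [block, Finset.coe_filter, Finset.mem_univ, true_and, Set.mem_ofPred_eq] at h h'
    rw [slot, slot, h.2.1, h'.2.1, Nat.add_left_cancel_iff] at heq
    have := card_filter_lt_injOn _ (by simp [h.1, h.2.1]) (by simp [h'.1, h'.2.1]) heq
    rw [this]
  · exact absurd heq (aux _ _ _ _ h' h hlt).ne'

theorem slot_lt_of_mem_block {G : SimpleGraph (Fin n)} (hn : 0 < n) {k i : ℕ}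
    {e : Fin n × Fin n} (h : e ∈ block G k i) : slot G e.1 e.2 < blockBound (degrees G) := by
  simp only [block, Finset.mem_filter, Finset.mem_univ, true_and] at h
  have h1 := card_lt_layerDegrees (mem_layerNeighbors.2 ⟨h.1, h.2.1⟩)
  have h2 := blockOffset_add_le_sum (D := layerDegrees G k) (a := numParts (degrees G)) e.1
  have h3 := sum_part_le G hn k (part_lt G hn k e.1)
  unfold part at h3
  rw [slot, h.2.1]
  omega

theorem card_filter_mod_le {ι : Type*} {s : Finset ι} {f : ι → ℕ} {b : ℕ}
    (hf : Set.InjOn f s) (hb : ∀ x ∈ s, f x < b) (z : ℕ) :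
    Finset.card {x ∈ s | f x % n = z} ≤ b / n + 1 := by
  rw [← Finset.card_range (b / n + 1)]
  refine Finset.card_le_card_of_injOn (fun x => f x / n) ?_ ?_
  · intro x hx
    have := hb x (Finset.mem_filter.1 hx).1
    simpa using Nat.lt_succ_of_le (Nat.div_le_div_right this.le)
  · intro x hx y hy h
    have hx := Finset.mem_filter.1 hx
    have hy := Finset.mem_filter.1 hy
    refine hf hx.1 hy.1 ?_
    simp only at h
    rw [← Nat.mod_add_div (f x) n, ← Nat.mod_add_div (f y) n, hx.2, hy.2, h]

/-- The number of 2-paths from `u` to `v` through layer `k`. -/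
noncomputable def layerCodegree (G : SimpleGraph (Fin n)) (k : ℕ) (u v : Fin n) : ℕ :=
  Finset.card {w | layer (degrees G) w = k ∧ G.Adj u w ∧ G.Adj v w}

theorem layerCodegree_lt (G : SimpleGraph (Fin n)) (k : ℕ) (u v : Fin n) :
    layerCodegree G k u v < n :=
  (Finset.card_le_card fun w hw => by simp at hw ⊢; exact hw.2.1).trans_lt (degrees_lt G u)

theorem codegree_lt (G : SimpleGraph (Fin n)) (u v : Fin n) : codegree G u v < n :=
  (Finset.card_le_card fun w hw => by simp at hw ⊢; exact hw.1).trans_lt (degrees_lt G u)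

theorem codegree_eq_sum (G : SimpleGraph (Fin n)) (hn : 0 < n) (u v : Fin n) :
    codegree G u v = ∑ k ∈ Finset.range (numLayers (degrees G)), layerCodegree G k u v := by
  rw [codegree, Finset.card_eq_sum_card_fiberwise (f := layer (degrees G))
    (t := Finset.range (numLayers (degrees G)))
    (fun w _ => by simpa using layer_lt G hn w)]
  refine Finset.sum_congr rfl fun k _ => ?_
  rw [layerCodegree, Finset.filter_filter]
  congr 1
  ext w
  simp only [Finset.mem_filter]
  tauto

/-- The node that forwards the contribution of layer `k` to the codegree of `u` and `v`. -/
noncomputable def relay (G : SimpleGraph (Fin n)) (k : ℕ) (u v : Fin n) : ℕ :=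
  ((descendingRank (layerDegrees G k) v : ℕ) +
    (descendingRank (layerDegrees G k) u : ℕ) / numParts (degrees G) % numParts (degrees G)) % n

theorem relay_injective (G : SimpleGraph (Fin n)) (k : ℕ) (u : Fin n) :
    Function.Injective (relay G k u) := by
  intro v v' h
  have h1 := Nat.ModEq.add_right_cancel' _ h
  have h2 := h1.eq_of_lt_of_lt (Fin.isLt _) (Fin.isLt _)
  exact (descendingRank _).injective (Fin.ext h2)

/-- Let r be the rank. In a block the last base-a digits of r(u) and r(v) are fixed. The relay fixes
r(v) + (second digit of r(u)) up to a carry of n, and reading this sum in base a recovers both r(v)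
and that digit. Only the carry, with 2 values, and ⌊r(u)/a²⌋, with at most c + 1 values, remain
free. -/
theorem card_relay_block_le (G : SimpleGraph (Fin n)) (hn : 0 < n) (k i j : ℕ) (z : Fin n) :
    Finset.card {e : Fin n × Fin n | part G k e.1 = i ∧ part G k e.2 = j ∧
      relay G k e.1 e.2 = z} ≤ 2 * (numLayers (degrees G) + 1) := by
  set a := numParts (degrees G) with ha
  have hapos : 0 < a := numParts_pos G hn
  have han : a ≤ n := by nlinarith [sq_numParts_le G hn]
  set r := descendingRank (layerDegrees G k) with hr
  have hcard : (Finset.range 2 ×ˢ Finset.range (numLayers (degrees G) + 1)).card =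
    2 * (numLayers (degrees G) + 1) := by simp
  rw [← hcard]
  refine Finset.card_le_card_of_injOn
    (fun e => (((r e.2 : ℕ) + (r e.1 : ℕ) / a % a) / n, (r e.1 : ℕ) / a / a)) ?_ ?_
  · rintro ⟨u, v⟩ _
    have h1 : (r u : ℕ) / a % a < a := Nat.mod_lt _ hapos
    have h2 := (r v).isLt
    have h3 : (r u : ℕ) / a / a ≤ n / a ^ 2 := by
      rw [Nat.div_div_eq_div_mul, ← sq]
      exact Nat.div_le_div_right (r u).isLt.le
    simp only [Finset.coe_product, Finset.coe_range, Set.mem_prod, Set.mem_Iio]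
    exact ⟨Nat.div_lt_of_lt_mul (by omega), Nat.lt_succ_of_le h3⟩
  · rintro ⟨u, v⟩ he ⟨u', v'⟩ he' h
    simp only [Finset.coe_filter, Finset.mem_univ, true_and, Set.mem_ofPred_eq] at he he'
    simp only [Prod.mk.injEq] at h
    obtain ⟨hu, hv, hz⟩ := he
    obtain ⟨hu', hv', hz'⟩ := he'
    have hu : (r u : ℕ) % a = i := hu
    have hv : (r v : ℕ) % a = j := hv
    have hu' : (r u' : ℕ) % a = i := hu'
    have hv' : (r v' : ℕ) % a = j := hv'
    have hz : ((r v : ℕ) + (r u : ℕ) / a % a) % n = z := hz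
    have hz' : ((r v' : ℕ) + (r u' : ℕ) / a % a) % n = z := hz'
    have hsum : (r v : ℕ) + (r u : ℕ) / a % a = (r v' : ℕ) + (r u' : ℕ) / a % a := by
      rw [← Nat.mod_add_div ((r v : ℕ) + (r u : ℕ) / a % a) n,
        ← Nat.mod_add_div ((r v' : ℕ) + (r u' : ℕ) / a % a) n, hz, hz', h.1]
    have ev := Nat.mod_add_div (r v : ℕ) a
    have ev' := Nat.mod_add_div (r v' : ℕ) a
    rw [hv] at ev
    rw [hv'] at ev'
    have hl := Nat.mod_lt ((r u : ℕ) / a) hapos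
    have hl' := Nat.mod_lt ((r u' : ℕ) / a) hapos
    have hsum' : (r u : ℕ) / a % a + a * ((r v : ℕ) / a) =
        (r u' : ℕ) / a % a + a * ((r v' : ℕ) / a) := by omega
    have hd : (r v : ℕ) / a = (r v' : ℕ) / a := by
      have := congrArg (· / a) hsum'
      simpa [Nat.add_mul_div_left _ _ hapos, Nat.div_eq_of_lt hl, Nat.div_eq_of_lt hl'] using this
    have hv2 : v = v' := r.injective (Fin.ext (by rw [← ev, ← ev', hd]))
    have hm : (r u : ℕ) / a % a = (r u' : ℕ) / a % a := by rw [hd] at hsum'; omega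
    have hq : (r u : ℕ) / a = (r u' : ℕ) / a := by
      rw [← Nat.mod_add_div ((r u : ℕ) / a) a, ← Nat.mod_add_div ((r u' : ℕ) / a) a, hm, h.2]
    have hu2 : u = u' := r.injective (Fin.ext (by
      rw [← Nat.mod_add_div (r u : ℕ) a, ← Nat.mod_add_div (r u' : ℕ) a, hu, hu', hq]))
    rw [hu2, hv2]

/-- This and the next three congruences say which knowledge suffices to compute a quantity locally.
-/
theorem layerNeighbors_congr {x y : SimpleGraph (Fin n)} {v : Fin n}
    (hN : neighbors x v = neighbors y v) (hd : degrees x = degrees y) (k : ℕ) :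
    layerNeighbors x k v = layerNeighbors y k v := by
  rw [layerNeighbors, layerNeighbors, hN, hd]

theorem part_congr {x y : SimpleGraph (Fin n)} (hd : degrees x = degrees y)
    (hD : layerDegrees x = layerDegrees y) : part x = part y := by
  funext k v
  rw [part, part, hd, hD]

theorem relay_congr {x y : SimpleGraph (Fin n)} (hd : degrees x = degrees y)
    (hD : layerDegrees x = layerDegrees y) : relay x = relay y := by
  funext k u v
  rw [relay, relay, hd, hD]

theorem slot_congr {x y : SimpleGraph (Fin n)} {v : Fin n}
    (hN : neighbors x v = neighbors y v) (hd : degrees x = degrees y)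
    (hD : layerDegrees x = layerDegrees y) (w : Fin n) : slot x v w = slot y v w := by
  rw [slot, slot, hd, hD, layerNeighbors_congr hN hd]

/-- The entries in row `v` of the adjacency matrix that `v` entrusts to `z`. -/
noncomputable def entrusted (G : SimpleGraph (Fin n)) (v z : Fin n) : Finset (Fin n) :=
  {w ∈ neighbors G v | slot G v w % n = z}

/-- The slots of row v in one layer are distinct and lie in an interval shorter than n, so at most
one of them per layer is z modulo n. -/
theorem card_entrusted_le (G : SimpleGraph (Fin n)) (hn : 0 < n) (v z : Fin n) :
    (entrusted G v z).card ≤ numLayers (degrees G) := by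
  rw [← Finset.card_range (numLayers (degrees G))]
  refine Finset.card_le_card_of_injOn (layer (degrees G)) ?_ ?_
  · intro w _
    simpa using layer_lt G hn w
  · intro w hw w' hw' h
    simp only [entrusted, Finset.coe_filter, mem_neighbors, Set.mem_ofPred_eq] at hw hw'
    have hm := mem_layerNeighbors.2 ⟨hw.1, rfl⟩
    have hm' := mem_layerNeighbors.2 ⟨hw'.1, h.symm⟩
    have h1 := card_lt_layerDegrees hm
    have h2 := card_lt_layerDegrees hm'
    have h3 := layerDegrees_lt G (layer (degrees G) w) v
    have e : slot G v w % n = slot G v w' % n := hw.2.trans hw'.2.symm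
    rw [slot, slot, ← h] at e
    have h4 := (Nat.ModEq.add_left_cancel' _ e).eq_of_lt_of_lt (h1.trans h3) (h2.trans h3)
    exact card_filter_lt_injOn _ hm hm' h4

/-- The node in charge of the product of the row part `i` and the column part `j` in layer `k`
is `(k * a + i) * a + j`, where `a` is the number of parts. -/
def nodeLayer (d : Fin n → ℕ) (p : Fin n) : ℕ := p / numParts d / numParts d

def nodeRow (d : Fin n → ℕ) (p : Fin n) : ℕ := p / numParts d % numParts d

def nodeColumn (d : Fin n → ℕ) (p : Fin n) : ℕ := p % numParts d

theorem exists_node (G : SimpleGraph (Fin n)) {k i j : ℕ}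
    (hk : k < numLayers (degrees G)) (hi : i < numParts (degrees G))
    (hj : j < numParts (degrees G)) :
    ∃ p : Fin n, nodeLayer (degrees G) p = k ∧ nodeRow (degrees G) p = i ∧
      nodeColumn (degrees G) p = j := by
  unfold numLayers at hk
  unfold nodeLayer nodeRow nodeColumn
  generalize numParts (degrees G) = a at *
  have ha : 0 < a := by omega
  have h1 : (k + 1) * a ^ 2 ≤ n := (Nat.le_div_iff_mul_le (by positivity)).1 hk
  have h2 : (k * a + i) * a + j < n := by nlinarith
  have h3 : ((k * a + i) * a + j) / a = k * a + i := by
    rw [mul_comm, Nat.mul_add_div ha, Nat.div_eq_of_lt hj, add_zero]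
  refine ⟨⟨(k * a + i) * a + j, h2⟩, ?_, ?_, ?_⟩
  · rw [h3, mul_comm, Nat.mul_add_div ha, Nat.div_eq_of_lt hi, add_zero]
  · rw [h3, mul_comm, Nat.mul_add_mod, Nat.mod_eq_of_lt hi]
  · simp only [mul_comm _ a]
    rw [Nat.mul_add_mod, Nat.mod_eq_of_lt hj]

/-- The entries entrusted to `z` that the node `p` needs. -/
noncomputable def forwarded (G : SimpleGraph (Fin n)) (z p : Fin n) : Finset (Fin n × Fin n) :=
  {e | e.2 ∈ entrusted G e.1 z ∧ layer (degrees G) e.2 = nodeLayer (degrees G) p ∧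
    (part G (nodeLayer (degrees G) p) e.1 = nodeRow (degrees G) p ∨
      part G (nodeLayer (degrees G) p) e.1 = nodeColumn (degrees G) p)}

theorem card_forwarded_le (G : SimpleGraph (Fin n)) (hn : 0 < n) (z p : Fin n) :
    (forwarded G z p).card ≤ 2 * (blockBound (degrees G) / n + 1) := by
  set k := nodeLayer (degrees G) p with hk
  set i := nodeRow (degrees G) p with hi
  set j := nodeColumn (degrees G) p with hj
  have hsub : forwarded G z p ⊆ {e ∈ block G k i | slot G e.1 e.2 % n = z} ∪
      {e ∈ block G k j | slot G e.1 e.2 % n = z} := by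
    intro e he
    simp only [forwarded, entrusted, Finset.mem_filter, Finset.mem_univ, true_and,
      mem_neighbors] at he
    simp only [Finset.mem_union, Finset.mem_filter, block, Finset.mem_univ, true_and]
    tauto
  have h : ∀ i, Finset.card {e ∈ block G k i | slot G e.1 e.2 % n = z} ≤
      blockBound (degrees G) / n + 1 := fun i =>
    card_filter_mod_le (slot_injOn_block G k i) (fun e he => slot_lt_of_mem_block hn he) z
  have := (Finset.card_le_card hsub).trans (Finset.card_union_le _ _)
  have := h i
  have := h j
  omega

/-- The contribution of `u` to the number of 4-cycles. -/
noncomputable def codegreePairs (G : SimpleGraph (Fin n)) (u : Fin n) : ℕ :=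
  ∑ v ∈ Finset.univ.erase u, (codegree G u v).choose 2

theorem codegreePairs_lt (G : SimpleGraph (Fin n)) (u : Fin n) : codegreePairs G u < n ^ 3 := by
  have hn : 0 < n := u.pos
  calc codegreePairs G u ≤ ∑ v ∈ Finset.univ.erase u, n ^ 2 :=
        Finset.sum_le_sum fun v _ =>
          (Nat.choose_le_pow _ _).trans (Nat.pow_le_pow_left (codegree_lt G u v).le 2)
    _ = (n - 1) * n ^ 2 := by simp [Finset.card_erase_of_mem]
    _ < n * n ^ 2 := Nat.mul_lt_mul_of_pos_right (by omega) (by positivity)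
    _ = n ^ 3 := by ring

/-! ### The communication phases. -/

section Phases

variable {B : ℕ}

theorem attainable_degrees (hB : n ^ 3 ≤ 2 ^ B) :
    Attainable neighbors B
      (fun v (x y : SimpleGraph (Fin n)) => neighbors x v = neighbors y v ∧ degrees x = degrees y)
      (fun _ => 0 + 1) := by
  refine ((attainable_zero neighbors B).step (Finset.range n) ?_ (fun x u _ => {degrees x u})
    (fun _ => 1) ?_ ?_ ?_ ?_).mono ?_
  · rw [Finset.card_range]
    exact (Nat.le_self_pow (by norm_num) n).trans hB
  · intro x u _
    simpa using degrees_lt x u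
  · simp
  · intro u x y h _
    simp [degrees, h]
  · simp
  · intro v x y h
    exact ⟨h.1, funext fun u => by simpa using h.2 u⟩

theorem attainable_layerDegrees {T : SimpleGraph (Fin n) → ℕ} (hn : 0 < n) (hB : n ^ 3 ≤ 2 ^ B)
    (h : Attainable neighbors B (fun v x y => neighbors x v = neighbors y v ∧
      degrees x = degrees y) T) :
    Attainable neighbors B (fun v x y => neighbors x v = neighbors y v ∧
      degrees x = degrees y ∧ layerDegrees x = layerDegrees y)
      (fun x => T x + numLayers (degrees x)) := by
  refine (h.step (Finset.range n ×ˢ Finset.range n) ?_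
    -- Values carry the tag k because a phase delivers only an unordered set.
    (fun x u _ => (Finset.range (numLayers (degrees x))).image
      fun k => (k, layerDegrees x k u))
    (fun x => numLayers (degrees x)) ?_ ?_ ?_ ?_).mono ?_
  · rw [Finset.card_product, Finset.card_range, ← sq]
    exact (Nat.pow_le_pow_right hn (by norm_num)).trans hB
  · intro x u _
    simp only [Finset.image_subset_iff, Finset.mem_product, Finset.mem_range]
    exact fun k hk => ⟨hk.trans_le (numLayers_le _), layerDegrees_lt x k u⟩
  · intro x u _
    exact Finset.card_image_le.trans (by simp)
  · intro u x y h _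
    simp only [h.2, layerDegrees, layerNeighbors_congr h.1 h.2]
  · intro u x y h
    rw [h.2]
  · rintro v x y ⟨⟨hN, hd⟩, h⟩
    refine ⟨hN, hd, funext fun k => funext fun u => ?_⟩
    by_cases hk : k < numLayers (degrees x)
    · have : (k, layerDegrees x k u) ∈ (Finset.range (numLayers (degrees y))).image
          fun k => (k, layerDegrees y k u) := by
        rw [← h u]
        exact Finset.mem_image_of_mem _ (Finset.mem_range.2 hk)
      obtain ⟨k', -, hk'⟩ := Finset.mem_image.1 this
      obtain ⟨rfl, e⟩ := Prod.mk.inj hk'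
      exact e.symm
    · rw [layerDegrees_eq_zero x hn (not_lt.1 hk), layerDegrees_eq_zero y hn (hd ▸ not_lt.1 hk)]

theorem attainable_entrusted {T : SimpleGraph (Fin n) → ℕ} (hn : 0 < n) (hB : n ^ 3 ≤ 2 ^ B)
    (h : Attainable neighbors B (fun v x y => neighbors x v = neighbors y v ∧
      degrees x = degrees y ∧ layerDegrees x = layerDegrees y) T) :
    Attainable neighbors B (fun z x y => degrees x = degrees y ∧
      layerDegrees x = layerDegrees y ∧
      ∀ v, entrusted x v z = entrusted y v z)
      (fun x => T x + numLayers (degrees x)) := by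
  refine (h.step Finset.univ ?_ entrusted
    (fun x => numLayers (degrees x)) ?_ ?_ ?_ ?_).mono ?_
  · rw [Finset.card_univ, Fintype.card_fin]
    exact (Nat.le_self_pow (by norm_num) n).trans hB
  · exact fun _ _ _ => Finset.subset_univ _
  · exact fun x u w => card_entrusted_le x hn u w
  · rintro u x y ⟨hN, hd, hD⟩ w
    simp only [entrusted, hN, slot_congr hN hd hD]
  · rintro u x y ⟨-, hd, -⟩
    rw [hd]
  · rintro v x y ⟨⟨-, hd, hD⟩, h⟩
    exact ⟨hd, hD, h⟩

theorem attainable_blocks {T : SimpleGraph (Fin n) → ℕ} (hn : 0 < n) (hB : n ^ 3 ≤ 2 ^ B)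
    (h : Attainable neighbors B (fun z x y => degrees x = degrees y ∧
      layerDegrees x = layerDegrees y ∧
      ∀ v, entrusted x v z = entrusted y v z) T) :
    Attainable neighbors B (fun p x y => degrees x = degrees y ∧
      layerDegrees x = layerDegrees y ∧
      ∀ v w, layer (degrees x) w = nodeLayer (degrees x) p →
        (part x (nodeLayer (degrees x) p) v = nodeRow (degrees x) p ∨
          part x (nodeLayer (degrees x) p) v = nodeColumn (degrees x) p) →
        (x.Adj v w ↔ y.Adj v w))
      (fun x => T x + 2 * (blockBound (degrees x) / n + 1)) := by
  refine (h.step Finset.univ ?_ forwarded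
    (fun x => 2 * (blockBound (degrees x) / n + 1)) ?_ ?_ ?_ ?_).mono ?_
  · rw [Finset.card_univ, Fintype.card_prod, Fintype.card_fin, ← sq]
    exact (Nat.pow_le_pow_right hn (by norm_num)).trans hB
  · exact fun _ _ _ => Finset.subset_univ _
  · exact fun x u w => card_forwarded_le x hn u w
  · rintro u x y ⟨hd, hD, hE⟩ w
    simp only [forwarded, hd, hE, part_congr hd hD]
  · rintro u x y ⟨hd, -⟩
    rw [hd]
  · rintro p x y ⟨⟨hd, hD, -⟩, h⟩
    refine ⟨hd, hD, ?_⟩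
    -- Every relevant entry is forwarded by the node `slot x v w % n`, so silence about a pair
    -- reveals a non-edge.
    have aux : ∀ {x y : SimpleGraph (Fin n)}, degrees x = degrees y →
        (∀ z, forwarded x z p = forwarded y z p) →
        ∀ v w, layer (degrees x) w = nodeLayer (degrees x) p →
        (part x (nodeLayer (degrees x) p) v = nodeRow (degrees x) p ∨
          part x (nodeLayer (degrees x) p) v = nodeColumn (degrees x) p) →
        x.Adj v w → y.Adj v w := by
      intro x y hd h v w hw hv hvw
      have : (v, w) ∈ forwarded x ⟨slot x v w % n, Nat.mod_lt _ hn⟩ p := by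
        simp only [forwarded, entrusted, Finset.mem_filter, Finset.mem_univ, true_and,
          mem_neighbors, and_true]
        exact ⟨hvw, hw, hv⟩
      rw [h] at this
      simp only [forwarded, entrusted, Finset.mem_filter, Finset.mem_univ, true_and,
          mem_neighbors] at this
      exact this.1.1
    intro v w hw hv
    refine ⟨aux hd h v w hw hv, aux hd.symm (fun z => (h z).symm) v w (hd ▸ hw) ?_⟩
    rw [← hd, ← part_congr hd hD]
    exact hv

theorem attainable_relays {T : SimpleGraph (Fin n) → ℕ} (hn : 0 < n) (hB : n ^ 3 ≤ 2 ^ B)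
    (h : Attainable neighbors B (fun p x y => degrees x = degrees y ∧
      layerDegrees x = layerDegrees y ∧
      ∀ v w, layer (degrees x) w = nodeLayer (degrees x) p →
        (part x (nodeLayer (degrees x) p) v = nodeRow (degrees x) p ∨
          part x (nodeLayer (degrees x) p) v = nodeColumn (degrees x) p) →
        (x.Adj v w ↔ y.Adj v w)) T) :
    Attainable neighbors B (fun z x y => degrees x = degrees y ∧
      layerDegrees x = layerDegrees y ∧
      ∀ k < numLayers (degrees x), ∀ u v, relay x k u v = z →
        layerCodegree x k u v = layerCodegree y k u v)
      (fun x => T x + 2 * (numLayers (degrees x) + 1)) := by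
  refine (h.step (Finset.univ ×ˢ Finset.range n) ?_
    (fun x p z => Finset.image
      (fun e : Fin n × Fin n => (e, layerCodegree x (nodeLayer (degrees x) p) e.1 e.2))
      {e | part x (nodeLayer (degrees x) p) e.1 = nodeRow (degrees x) p ∧
        part x (nodeLayer (degrees x) p) e.2 = nodeColumn (degrees x) p ∧
        relay x (nodeLayer (degrees x) p) e.1 e.2 = z})
    (fun x => 2 * (numLayers (degrees x) + 1)) ?_ ?_ ?_ ?_).mono ?_
  · rw [Finset.card_product, Finset.card_univ, Fintype.card_prod, Fintype.card_fin,
      Finset.card_range]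
    exact (by ring : n * n * n = n ^ 3).trans_le hB
  · intro x p z
    simp only [Finset.image_subset_iff, Finset.mem_product, Finset.mem_univ, true_and,
      Finset.mem_range]
    exact fun e _ => layerCodegree_lt _ _ _ _
  · exact fun x p z => Finset.card_image_le.trans (card_relay_block_le x hn _ _ _ z)
  · rintro p x y ⟨hd, hD, hE⟩ z
    simp only [← hd, ← part_congr hd hD, ← relay_congr hd hD]
    refine Finset.image_congr ?_
    rintro ⟨u, v⟩ he
    simp only [Finset.coe_filter, Finset.mem_univ, true_and, Set.mem_ofPred_eq] at he
    simp only [Prod.mk.injEq, true_and, layerCodegree, ← hd]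
    congr 1
    ext w
    simp only [Finset.mem_filter, Finset.mem_univ, true_and]
    refine and_congr_right fun hw => ?_
    -- Both rows are known to p: u lies in its row part and v in its column part.
    rw [hE u w hw (.inl he.1), hE v w hw (.inr he.2.1)]
  · rintro u x y ⟨hd, -⟩
    rw [hd]
  · rintro z x y ⟨⟨hd, hD, -⟩, h⟩
    refine ⟨hd, hD, fun k hk u v huv => ?_⟩
    obtain ⟨p, rfl, hpr, hpc⟩ := exists_node x hk (part_lt x hn k u) (part_lt x hn k v)
    have hmem := (Finset.ext_iff.1 (h p) _).1 (Finset.mem_image_of_mem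
      (fun e : Fin n × Fin n => (e, layerCodegree x (nodeLayer (degrees x) p) e.1 e.2))
      (a := (u, v)) (by simpa using ⟨hpr.symm, hpc.symm, huv⟩))
    obtain ⟨e, -, he⟩ := Finset.mem_image.1 hmem
    obtain ⟨rfl, he⟩ := Prod.mk.inj he
    rw [← he, hd]

/-- For fixed k and u distinct v have distinct relays, so a relay owes u at most one value per
layer. -/
theorem attainable_codegrees {T : SimpleGraph (Fin n) → ℕ} (hn : 0 < n) (hB : n ^ 3 ≤ 2 ^ B)
    (h : Attainable neighbors B (fun z x y => degrees x = degrees y ∧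
      layerDegrees x = layerDegrees y ∧
      ∀ k < numLayers (degrees x), ∀ u v, relay x k u v = z →
        layerCodegree x k u v = layerCodegree y k u v) T) :
    Attainable neighbors B (fun u x y => ∀ v, codegree x u v = codegree y u v)
      (fun x => T x + numLayers (degrees x)) := by
  refine (h.step (Finset.range n ×ˢ Finset.univ ×ˢ Finset.range n) ?_
    (fun x z u => Finset.image
      (fun e : ℕ × Fin n => (e.1, e.2, layerCodegree x e.1 u e.2))
      {e ∈ Finset.range (numLayers (degrees x)) ×ˢ Finset.univ | relay x e.1 u e.2 = z})
    (fun x => numLayers (degrees x)) ?_ ?_ ?_ ?_).mono ?_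
  · rw [Finset.card_product, Finset.card_product, Finset.card_univ, Fintype.card_fin,
      Finset.card_range]
    exact (by ring : n * (n * n) = n ^ 3).trans_le hB
  · intro x z u
    simp only [Finset.image_subset_iff, Finset.mem_product, Finset.mem_univ, true_and,
      Finset.mem_range, Finset.mem_filter]
    exact fun e he => ⟨he.1.1.trans_le (numLayers_le _), layerCodegree_lt _ _ _ _⟩
  · intro x z u
    refine Finset.card_image_le.trans ?_
    refine (Finset.card_le_card_of_injOn (t := Finset.range (numLayers (degrees x))) Prod.fst
      ?_ ?_).trans_eq (Finset.card_range _)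
    · intro e he
      simp only [Finset.coe_filter, Finset.mem_product, Set.mem_ofPred_eq] at he
      exact he.1.1
    · rintro ⟨k, v⟩ he ⟨k', v'⟩ he' hk
      obtain rfl : k = k' := hk
      simp only [Finset.coe_filter, Set.mem_ofPred_eq] at he he'
      rw [relay_injective x k u (he.2.trans he'.2.symm)]
  · rintro z x y ⟨hd, hD, hE⟩ u
    simp only [← hd, ← relay_congr hd hD]
    refine Finset.image_congr ?_
    rintro ⟨k, v⟩ he
    simp only [Finset.coe_filter, Finset.mem_product, Finset.mem_range, Set.mem_ofPred_eq] at he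
    simp only [hE k he.1.1 u v he.2]
  · rintro u x y ⟨hd, -⟩
    rw [hd]
  · rintro u x y ⟨⟨hd, hD, -⟩, h⟩ v
    rw [codegree_eq_sum x hn, codegree_eq_sum y hn, ← hd]
    refine Finset.sum_congr rfl fun k hk => ?_
    have hmem := (Finset.ext_iff.1 (h ⟨relay x k u v, Nat.mod_lt _ hn⟩) _).1
      (Finset.mem_image_of_mem (fun e : ℕ × Fin n => (e.1, e.2, layerCodegree x e.1 u e.2))
        (a := (k, v)) (by simpa using hk))
    obtain ⟨⟨k', v'⟩, -, he⟩ := Finset.mem_image.1 hmem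
    simp only [Prod.mk.injEq] at he
    obtain ⟨rfl, rfl, he⟩ := he
    exact he.symm

theorem attainable_codegreePairs {T : SimpleGraph (Fin n) → ℕ} (hB : n ^ 3 ≤ 2 ^ B)
    (h : Attainable neighbors B (fun u x y => ∀ v, codegree x u v = codegree y u v) T) :
    Attainable neighbors B (fun _ x y => ∀ u, codegreePairs x u = codegreePairs y u)
      (fun x => T x + 1) := by
  refine (h.step (Finset.range (n ^ 3)) (by simpa using hB) (fun x u _ => {codegreePairs x u})
    (fun _ => 1) ?_ ?_ ?_ ?_).mono ?_
  · intro x u _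
    simpa using codegreePairs_lt x u
  · simp
  · intro u x y h _
    simp only [codegreePairs, h]
  · simp
  · intro v x y h u
    simpa using h.2 u

end Phases

/-- The number of rounds for a graph with the degrees `d`. -/
def numRounds (d : Fin n → ℕ) : ℕ :=
  0 + 1 + numLayers d + numLayers d + 2 * (blockBound d / n + 1) + 2 * (numLayers d + 1) +
    numLayers d + 1

theorem exists_algorithm_four_cycles (hn : 0 < n) {B : ℕ} (hB : n ^ 3 ≤ 2 ^ B) :
    ∃ A : CongestedCliqueAlgorithm n B (Finset (Fin n)) ℕ, ∀ G : SimpleGraph (Fin n),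
      A.AllOutputWithin (neighbors G) (numRounds (degrees G))
        (G.copyCount (SimpleGraph.cycleGraph 4)) := by
  have h := attainable_codegreePairs hB <| attainable_codegrees hn hB <| attainable_relays hn hB <|
    attainable_blocks hn hB <| attainable_entrusted hn hB <| attainable_layerDegrees hn hB <|
    attainable_degrees hB
  refine h.exists_algorithm (fun G => G.copyCount (SimpleGraph.cycleGraph 4)) ?_
  intro _ x y hxy
  have hx := four_mul_copyCount_cycleGraph_four x
  have hy := four_mul_copyCount_cycleGraph_four y
  have : ∑ u, codegreePairs x u = ∑ u, codegreePairs y u := Finset.sum_congr rfl fun u _ => hxy u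
  simp only [codegreePairs] at this
  omega

end FourCycles

/-! ### The number of rounds. -/

section RoundBound

variable {n : ℕ}

theorem sum_div_div_le (S c a : ℕ) : (((S / c + n) / a : ℕ) : ℝ) ≤ (S : ℝ) / c / a + n := by
  have h1 : (((S / c + n) / a : ℕ) : ℝ) ≤ ((S / c + n : ℕ) : ℝ) / a := Nat.cast_div_le
  have h2 : ((S / c : ℕ) : ℝ) ≤ (S : ℝ) / c := Nat.cast_div_le
  rcases Nat.eq_zero_or_pos a with rfl | ha
  · simp
  have ha' : (1 : ℝ) ≤ a := by exact_mod_cast ha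
  have h3 : (n : ℝ) / a ≤ n := div_le_self (by positivity) ha'
  have h4 : ((S / c : ℕ) : ℝ) / a ≤ (S : ℝ) / c / a := by gcongr
  push_cast at h1
  rw [add_div] at h1
  linarith

/-- `numLayers d` is `O(m ^ (2 / 3) / n + 1)`, where `X ^ 3 = m` is the number of edges. -/
theorem numLayers_le_real (hn : 0 < n) {d : Fin n → ℕ} (hd : ∑ v, d v ≤ n ^ 2) {X : ℝ}
    (hX : 0 ≤ X) (hS : ((∑ v, d v : ℕ) : ℝ) = 2 * X ^ 3) :
    (numLayers d : ℝ) ≤ 16 * (X ^ 2 / n) + 4 := by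
  obtain ⟨ha, -, -⟩ := numParts_spec hn hd
  have hmax := numParts_maximal d
  unfold numLayers
  generalize numParts d = a at *
  have hn' : (0 : ℝ) < n := by exact_mod_cast hn
  have ha' : (1 : ℝ) ≤ a := by exact_mod_cast ha
  have h1 : ((n / a ^ 2 : ℕ) : ℝ) ≤ (n : ℝ) / (a : ℝ) ^ 2 := by
    exact_mod_cast (Nat.cast_div_le : ((n / a ^ 2 : ℕ) : ℝ) ≤ (n : ℝ) / (a ^ 2 : ℕ))
  refine h1.trans ?_
  rw [div_le_iff₀ (by positivity)]
  have hXn : 0 ≤ X ^ 2 / n := by positivity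
  -- By maximality a + 1 fails one constraint. If n < (a + 1)² ≤ 4a², then n/a² ≤ 4; otherwise n <
  -- 4aX, so n/a² ≤ 16X²/n.
  rcases hmax with h | h
  · have h : (n : ℝ) < (a + 1) ^ 2 := by exact_mod_cast h
    nlinarith [mul_nonneg hXn (sq_nonneg (a : ℝ))]
  · have h : (n : ℝ) ^ 3 < (a + 1) ^ 3 * ((∑ v, d v : ℕ) : ℝ) := by exact_mod_cast h
    rw [hS] at h
    have h2 : (n : ℝ) < 4 * a * X := by
      refine lt_of_pow_lt_pow_left₀ 3 (by positivity) (h.trans_le ?_)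
      have : ((a : ℝ) + 1) ^ 3 ≤ (2 * a) ^ 3 := by gcongr; linarith
      have hX3 : 0 ≤ X ^ 3 := by positivity
      have ha3 : 0 ≤ (a : ℝ) ^ 3 := by positivity
      nlinarith [mul_le_mul_of_nonneg_right this hX3, mul_nonneg ha3 hX3]
    have h3 : (n : ℝ) * n ≤ (4 * a * X) * (4 * a * X) :=
      mul_le_mul h2.le h2.le hn'.le (by positivity)
    have h4 : (n : ℝ) ≤ 16 * (X ^ 2 / n) * (a : ℝ) ^ 2 := by
      rw [show 16 * (X ^ 2 / n) * (a : ℝ) ^ 2 = (4 * a * X) * (4 * a * X) / n by ring,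
        le_div_iff₀ hn']
      exact h3
    nlinarith [sq_nonneg (a : ℝ)]

theorem blockBound_le_real (hn : 0 < n) {d : Fin n → ℕ} (hd : ∑ v, d v ≤ n ^ 2) {X : ℝ}
    (hX : 0 ≤ X) (hS : ((∑ v, d v : ℕ) : ℝ) = 2 * X ^ 3) :
    ((blockBound d / n : ℕ) : ℝ) ≤ 4 * (X ^ 2 / n) + 2 := by
  obtain ⟨ha, han, haS⟩ := numParts_spec hn hd
  have hc : 0 < n / numParts d ^ 2 := Nat.div_pos han (by positivity)
  -- Rounding down a quotient that is at least 1 loses less than a factor 2.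
  have hcn : n < 2 * (numParts d ^ 2 * (n / numParts d ^ 2)) := by
    have h1 := Nat.lt_mul_div_succ n (show 0 < numParts d ^ 2 by positivity)
    have : numParts d ^ 2 * (n / numParts d ^ 2 + 1) ≤
        2 * (numParts d ^ 2 * (n / numParts d ^ 2)) := by 
      nlinarith [pow_pos ha 2]
    omega
  have h0 := sum_div_div_le (n := n) (∑ v, d v) (n / numParts d ^ 2) (numParts d)
  have h1 : ((blockBound d / n : ℕ) : ℝ) ≤ ((blockBound d : ℕ) : ℝ) / n := Nat.cast_div_le
  unfold blockBound numLayers at *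
  generalize numParts d = a at *
  generalize n / a ^ 2 = c at *
  refine h1.trans ?_
  have hn' : (0 : ℝ) < n := by exact_mod_cast hn
  have ha' : (0 : ℝ) < a := by exact_mod_cast ha
  have hc' : (0 : ℝ) < c := by exact_mod_cast hc
  have hcn' : (n : ℝ) < 2 * ((a : ℝ) ^ 2 * c) := by exact_mod_cast hcn
  have haS' : (a : ℝ) ^ 3 * ((∑ v, d v : ℕ) : ℝ) ≤ n ^ 3 := by exact_mod_cast haS
  rw [hS] at haS' h0
  have haX : a * X ≤ n := by
    refine le_of_pow_le_pow_left₀ (n := 3) (by norm_num) hn'.le (le_trans ?_ haS')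
    rw [mul_pow]
    have : 0 ≤ (a : ℝ) ^ 3 * X ^ 3 := by positivity
    linarith
  rw [div_le_iff₀ hn', Nat.cast_add]
  refine (add_le_add_left h0 _).trans ?_
  -- From aX ≤ n < 2a²c follows X < 2ac.
  have h5 : 2 * X ^ 3 / c / a ≤ 4 * X ^ 2 := by
    rw [div_div, div_le_iff₀ (by positivity)]
    have h6 : a * X < 2 * (a ^ 2 * c) := haX.trans_lt hcn'
    have h7 : X < 2 * (a * c) := by
      refine lt_of_mul_lt_mul_left (h6.trans_eq ?_) ha'.le
      ring
    nlinarith [mul_le_mul_of_nonneg_left h7.le (sq_nonneg X)]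
  have h8 : (4 * (X ^ 2 / n) + 2) * n = 4 * X ^ 2 + 2 * n := by field_simp
  rw [h8]
  linarith

theorem numRounds_le (hn : 0 < n) {d : Fin n → ℕ} (hd : ∑ v, d v ≤ n ^ 2) {m : ℕ}
    (hm : ∑ v, d v = 2 * m) :
    (numRounds d : ℝ) ≤ 100 * ((m : ℝ) ^ (2 / 3 : ℝ) / n + 1) := by
  have hX : 0 ≤ (m : ℝ) ^ (1 / 3 : ℝ) := by positivity
  have hX3 : ((m : ℝ) ^ (1 / 3 : ℝ)) ^ 3 = m := by
    rw [← Real.rpow_natCast, ← Real.rpow_mul (by positivity)]; norm_num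
  have hX2 : ((m : ℝ) ^ (1 / 3 : ℝ)) ^ 2 = (m : ℝ) ^ (2 / 3 : ℝ) := by
    rw [← Real.rpow_natCast, ← Real.rpow_mul (by positivity)]; norm_num
  have hS : ((∑ v, d v : ℕ) : ℝ) = 2 * ((m : ℝ) ^ (1 / 3 : ℝ)) ^ 3 := by
    rw [hX3, hm]; push_cast; ring
  have h1 := numLayers_le_real hn hd hX hS
  have h2 := blockBound_le_real hn hd hX hS
  rw [hX2] at h1 h2
  have h3 : 0 ≤ (m : ℝ) ^ (2 / 3 : ℝ) / n := by positivity
  unfold numRounds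
  push_cast at h1 h2 ⊢
  -- With Y = m^(2/3)/n, c ≤ 16Y + 4 and b = ⌊`blockBound`/n⌋ ≤ 4Y + 2, the total 5c + 2b + 6 is at
  -- most 88Y + 30.
  linarith

end RoundBound

theorem exists_algorithm_within (n : ℕ) :
    ∃ A : CongestedCliqueAlgorithm n (3 * Nat.clog 2 n) (Finset (Fin n)) ℕ,
      ∀ (G : SimpleGraph (Fin n)) [DecidableRel G.Adj], ∃ T : ℕ,
        (T : ℝ) ≤ 100 * ((G.edgeFinset.card : ℝ) ^ (2 / 3 : ℝ) / (n : ℝ) + 1) ∧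
        A.AllOutputWithin (fun v => G.neighborFinset v) T
          (G.copyCount (SimpleGraph.cycleGraph 4)) := by
  rcases Nat.eq_zero_or_pos n with rfl | hn
  · obtain ⟨A, -⟩ := (attainable_zero (neighbors (n := 0)) (3 * Nat.clog 2 0)).exists_algorithm
      (fun _ => 0) (fun _ _ _ _ => rfl)
    exact ⟨A, fun G _ => ⟨0, by simp, fun v => v.elim0⟩⟩
  -- The longest messages, such as a pair of nodes with a count, take n³ values; hence the factor 3.
  · have hB : n ^ 3 ≤ 2 ^ (3 * Nat.clog 2 n) := by
      rw [mul_comm, pow_mul]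
      exact Nat.pow_le_pow_left (Nat.le_pow_clog (by norm_num) n) 3
    obtain ⟨A, hA⟩ := exists_algorithm_four_cycles hn hB
    refine ⟨A, fun G _ => ⟨numRounds (degrees G), ?_, ?_⟩⟩
    · refine numRounds_le hn (sum_degrees_le G) ?_
      rw [← G.sum_degrees_eq_twice_card_edges]
      refine Finset.sum_congr rfl fun v _ => ?_
      rw [degrees, ← G.card_neighborFinset_eq_degree]
      congr 1
      ext w
      simp
    · have : (fun v => G.neighborFinset v) = neighbors G := by
        funext v
        ext w
        simp
      rw [this]
      exact hA G

theorem theorem2 :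
    ∃ (c : ℕ) (A : (n : ℕ) → CongestedCliqueAlgorithm n (c * Nat.clog 2 n) (Finset (Fin n)) ℕ)
      (C : ℝ),
      ∀ (n : ℕ) (G : SimpleGraph (Fin n)) [DecidableRel G.Adj],
        ∃ T : ℕ,
          (T : ℝ) ≤ C * ((G.edgeFinset.card : ℝ) ^ (2 / 3 : ℝ) / (n : ℝ) + 1) ∧
          (A n).AllOutputWithin (fun v => G.neighborFinset v) T
            (G.copyCount (SimpleGraph.cycleGraph 4)) := by
  choose A hA using exists_algorithm_within
  exact ⟨3, A, 100, fun n G _ => hA n G⟩
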